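/- Let $\tau\in\mathbb C$ with $\operatorname{Im}\tau>0$, let $\Lambda=\mathbb Z+\tau\mathbb Z$, and put $$\theta_1(z)=-\sum_{n=-\infty}^{\infty}e^{2\pi i(z+\frac12)(n+\frac12)+\pi i\tau(n+\frac12)^2},\qquad \sigma_\lambda(z)=\frac{\theta_1(z-\lambda)\,\theta_1'(0)}{\theta_1(z)\,\theta_1(-\lambda)}\qquad(\lambda,z\in\mathbb C\setminus\Lambda).$$ Let $\wp$ and $\zeta$ be the Weierstrass functions with periods $1,\tau$, that is, $$\wp(z)=\frac1{z^2}+\sum_{\omega\in\Lambda\setminus\{0\}}\Bigl(\frac1{(z-\omega)^2}-\frac1{\omega^2}\Bigr),\qquad \zeta(z)=\frac1z+\sum_{\omega\in\Lambda\setminus\{0\}}\Bigl(\frac1{z-\omega}+\frac1\omega+\frac z{\omega^2}\Bigr),$$ and let $\eta_1=\zeta(\tfrac12)$. Then, for all complex $\lambda,\mu,z,w$ for which the terms involved are defined (that is, $\lambda,z\notin\Lambda$ in (i), (ii), (iv); $\lambda,\mu,\lambda+\mu,z,w,z-w\notin\Lambda$ in (iii); $z\notin\Lambda$ in (v)): (i)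 $\sigma_\lambda(z)=-\sigma_{-\lambda}(-z)$; (ii) $\sigma_\lambda(z)=-\sigma_z(\lambda)$; (iii) $\sigma_\lambda(z)\sigma_\mu(w)-\sigma_{\lambda+\mu}(w)\sigma_\lambda(z-w)-\sigma_\mu(w-z)\sigma_{\lambda+\mu}(z)=0$; (iv) $\sigma_\lambda(z)\sigma_{-\lambda}(z)=\wp(z)-\wp(\lambda)$; (v) for every $\lambda\notin\Lambda$ the function $\sigma_\lambda$ is complex differentiable at $z$, and $\lim_{\lambda\to0}\sigma_\lambda'(z)=-\wp(z)-2\eta_1$, where the prime denotes the derivative in $z$ and the limit is over $\lambda\neq0$. -/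

import Mathlib

open Filter Topology

noncomputable section

namespace EllipticDunkl

/-- Jacobi's theta function
`θ₁(z) = -∑_{n ∈ ℤ} exp (2πi (z + 1/2)(n + 1/2) + πi τ (n + 1/2)²)`. -/
def theta₁ (τ z : ℂ) : ℂ :=
  -∑' n : ℤ, Complex.exp (2 * Real.pi * Complex.I * (z + 1 / 2) * (n + 1 / 2)
    + Real.pi * Complex.I * τ * (n + 1 / 2) ^ 2)

/-- The theta series converges absolutely for `τ` in the upper half plane. -/
theorem summable_theta₁ {τ : ℂ} (hτ : 0 < τ.im) (z : ℂ) :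
    Summable fun n : ℤ => Complex.exp (2 * Real.pi * Complex.I * (z + 1 / 2) * (n + 1 / 2)
      + Real.pi * Complex.I * τ * (n + 1 / 2) ^ 2) := by
  have h := ((summable_jacobiTheta₂_term_iff (z + 1 / 2 + τ / 2) τ).mpr hτ).mul_left
    (Complex.exp (Real.pi * Complex.I * (z + 1 / 2) + Real.pi * Complex.I * τ / 4))
  refine h.congr fun n => ?_
  rw [jacobiTheta₂_term, ← Complex.exp_add]
  congr 1
  ring

/-- The function
`σ_λ(z) = θ₁(z - λ) θ₁'(0) / (θ₁(z) θ₁(-λ))`, meant for `λ` and `z` outside `ℤ + τℤ`. -/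
def sigma (τ l z : ℂ) : ℂ :=
  theta₁ τ (z - l) * deriv (theta₁ τ) 0 / (theta₁ τ z * theta₁ τ (-l))

/-- The pair of periods `1`, `τ`. Its `lattice` is `ℤ + τℤ`. -/
def periods (τ : ℂ) (hτ : 0 < τ.im) : PeriodPair where
  ω₁ := 1
  ω₂ := τ
  indep := by
    rw [LinearIndependent.pair_iff]
    intro s t h
    have him := congrArg Complex.im h
    have ht : t = 0 := by
      simp at him
      rcases him with h' | h'
      · exact h'
      · exact absurd h' hτ.ne'
    subst ht
    have hre := congrArg Complex.re h
    simpa using hre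

/-- The Weierstrass zeta function
`ζ(z) = 1/z + ∑_{ω ∈ L, ω ≠ 0} (1/(z - ω) + 1/ω + z/ω²)`. -/
def weierstrassZeta (L : PeriodPair) (z : ℂ) : ℂ :=
  1 / z + ∑' ω : {ω : L.lattice // ω ≠ 0},
    (1 / (z - (ω.1 : ℂ)) + 1 / (ω.1 : ℂ) + z / (ω.1 : ℂ) ^ 2)

end EllipticDunkl

end

namespace EllipticDunkl

/-! Everything follows from rigidity of entire functions under translation by `1` and `τ`, proved
with Fourier coefficients instead of the argument principle. Shifting the contour by `τ` relates the
coefficients to one another. Hence entire doubly periodic functions are constant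
(`exists_eq_const_of_periodic`), and entire functions with the multipliers of `θ₁` are multiples of
`θ₁` (`exists_eq_const_mul_theta₁`).

The second fact locates the zeros of `θ₁`: an elliptic function all of whose poles are cancelled by
zeros of `θ₁` is constant. An extra zero `a` would make `ζ(z - a) - ζ(z)` constant, and a double
zero at `0` would make `℘` constant.

Parts (i) and (ii) are oddness of `θ₁`. For (iv), the product and `℘` have the same principal part
at `0`, so they differ by a constant, which is read off at `z = λ`. From (iv) comes Weierstrass'
three-term identity, a Plücker relation, and (iii) is that identity with denominators cleared. For
(v), the limit is `(θ₁'/θ₁)'(z)`; `θ₁'/θ₁ - ζ` is entire with constant derivative, and its values at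
`±1/2` give the constant `-2η₁`. -/

/-! ### Fourier coefficients and rigidity of entire quasi-periodic functions -/

/-- Cauchy's theorem on a rectangle of width one and height `s.im`: its vertical sides cancel by
periodicity. -/
theorem integral_add_of_periodic {G : ℂ → ℂ} (hG : Differentiable ℂ G)
    (hp : ∀ z, G (z + 1) = G z) (s : ℂ) :
    ∫ x : ℝ in (0 : ℝ)..1, G (x + s) = ∫ x : ℝ in (0 : ℝ)..1, G x := by
  have hrect := Complex.integral_boundary_rect_eq_zero_of_differentiableOn G (s.re : ℂ)
    ((s.re + 1 : ℝ) + s.im * Complex.I) hG.differentiableOn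
  have e1 : ∀ y : ℝ, G (((s.re + 1 : ℝ) : ℂ) + y * Complex.I) = G (s.re + y * Complex.I) := by
    intro y
    rw [← hp (s.re + y * Complex.I)]
    congr 1
    push_cast
    ring
  have e2 : ∫ x : ℝ in s.re..s.re + 1, G x = ∫ x : ℝ in (0 : ℝ)..1, G x := by
    have : Function.Periodic (fun x : ℝ => G x) 1 := fun x => by
      simpa using hp x
    simpa using this.intervalIntegral_add_eq s.re 0
  have e3 : ∫ x : ℝ in (0 : ℝ)..1, G (x + s)
      = ∫ x : ℝ in s.re..s.re + 1, G (x + s.im * Complex.I) := by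
    have := intervalIntegral.integral_comp_add_right (a := 0) (b := 1)
      (fun x : ℝ => G (x + s.im * Complex.I)) s.re
    rw [zero_add, add_comm 1 s.re] at this
    rw [← this]
    congr 1
    ext x
    congr 1
    conv_lhs => rw [← Complex.re_add_im s]
    push_cast
    ring
  have e4 : ((s.re + 1 : ℝ) + s.im * Complex.I : ℂ).re = s.re + 1 := by simp
  have e5 : ((s.re + 1 : ℝ) + s.im * Complex.I : ℂ).im = s.im := by simp
  rw [e4, e5] at hrect
  simp only [e1, Complex.ofReal_re, Complex.ofReal_im, Complex.ofReal_zero, zero_mul,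
    add_zero] at hrect
  rw [e3, ← e2]
  linear_combination -hrect

/-- The `n`-th Fourier coefficient of the restriction of `F` to the real line. -/
noncomputable def fourierIntegral (F : ℂ → ℂ) (n : ℤ) : ℂ :=
  ∫ x : ℝ in (0 : ℝ)..1, Complex.exp (-(2 * Real.pi * Complex.I * n * x)) * F x

theorem eq_zero_of_eqOn_real {G : ℂ → ℂ} (hG : Differentiable ℂ G)
    (h : ∀ x : ℝ, G x = 0) (z : ℂ) : G z = 0 := by
  have ha : AnalyticOnNhd ℂ G Set.univ := fun z _ => hG.analyticAt z
  refine ha.eqOn_zero_of_preconnected_of_frequently_eq_zero isPreconnected_univ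
    (Set.mem_univ 0) ?_ (Set.mem_univ z)
  have ht : Tendsto (fun x : ℝ => (x : ℂ)) (𝓝[≠] 0) (𝓝[≠] 0) := by
    refine tendsto_nhdsWithin_of_tendsto_nhds_of_eventually_within _ ?_ ?_
    · simpa using (Complex.continuous_ofReal.tendsto 0).mono_left nhdsWithin_le_nhds
    · filter_upwards [self_mem_nhdsWithin] with x hx
      simpa using hx
  exact ht.frequently (Eventually.of_forall h).frequently

/-- The Fourier series is trivially summable, so it converges uniformly to `f`; its sum is `0`. -/
theorem eq_zero_of_fourierCoeff (f : C(UnitAddCircle, ℂ)) (hc : ∀ n, fourierCoeff f n = 0) :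
    f = 0 := by
  have hs := hasSum_fourier_series_of_summable (f := f) (by
    rw [funext hc]; exact summable_zero)
  refine hs.unique ?_
  have : (fun i => fourierCoeff f i • fourier (T := 1) i) = fun _ => (0 : C(UnitAddCircle, ℂ)) := by
    funext i
    ext x
    rw [hc, ContinuousMap.smul_apply, zero_smul, ContinuousMap.zero_apply]
  rw [this]
  exact hasSum_zero

theorem eq_zero_of_fourierIntegral {G : ℂ → ℂ} (hG : Differentiable ℂ G)
    (hp : ∀ z, G (z + 1) = G z) (h : ∀ n, fourierIntegral G n = 0) (z : ℂ) : G z = 0 := by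
  refine eq_zero_of_eqOn_real hG (fun x => ?_) z
  have hper : Function.Periodic (fun x : ℝ => G x) 1 := fun x => by simpa using hp x
  let f : C(UnitAddCircle, ℂ) := ⟨hper.lift, by
    exact continuous_coinduced_dom.mpr (hG.continuous.comp Complex.continuous_ofReal)⟩
  have hf : ∀ x : ℝ, f x = G x := fun x => rfl
  have hc : ∀ n, fourierCoeff f n = 0 := by
    intro n
    rw [fourierCoeff_eq_intervalIntegral f n 0]
    have := h n
    rw [fourierIntegral] at this
    simp only [zero_add, div_one, one_smul]
    rw [← this]
    congr 1
    ext x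
    rw [hf, fourier_coe_apply, smul_eq_mul]
    congr 2
    push_cast
    ring
  rw [← hf, eq_zero_of_fourierCoeff f hc, ContinuousMap.zero_apply]

/-- Move the contour by `τ`: the factor `exp (-2πikz)` in the multiplier turns index `n` into `n +
k`. -/
theorem fourierIntegral_shift {τ A : ℂ} {k : ℤ} {F : ℂ → ℂ} (hF : Differentiable ℂ F)
    (hp : ∀ z, F (z + 1) = F z)
    (hq : ∀ z, F (z + τ) = A * Complex.exp (-(2 * Real.pi * Complex.I * k * z)) * F z) (n : ℤ) :
    fourierIntegral F n
      = A * Complex.exp (-(2 * Real.pi * Complex.I * n * τ)) * fourierIntegral F (n + k) := by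
  have := integral_add_of_periodic
    (G := fun z => Complex.exp (-(2 * Real.pi * Complex.I * n * z)) * F z) (by fun_prop)
    (fun z => by
      simp only [hp]
      congr 1
      rw [mul_add, neg_add, Complex.exp_add, mul_one]
      have : Complex.exp (-(2 * Real.pi * Complex.I * n)) = 1 := by
        rw [Complex.exp_eq_one_iff]
        exact ⟨-n, by push_cast; ring⟩
      rw [this, mul_one]) τ
  rw [fourierIntegral, ← this, fourierIntegral, ← intervalIntegral.integral_const_mul]
  congr 1
  ext x
  rw [hq]
  have e : Complex.exp (-(2 * Real.pi * Complex.I * n * (x + τ)))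
      * Complex.exp (-(2 * Real.pi * Complex.I * k * x))
      = Complex.exp (-(2 * Real.pi * Complex.I * n * τ))
        * Complex.exp (-(2 * Real.pi * Complex.I * (n + k : ℤ) * x)) := by
    rw [← Complex.exp_add, ← Complex.exp_add]
    congr 1
    push_cast
    ring
  linear_combination (A * F x) * e

theorem fourierIntegral_sub_const_mul {F G : ℂ → ℂ} (hF : Differentiable ℂ F)
    (hG : Differentiable ℂ G) (c : ℂ) (n : ℤ) :
    fourierIntegral (fun z => F z - c * G z) n
      = fourierIntegral F n - c * fourierIntegral G n := by
  have hi : ∀ {F : ℂ → ℂ}, Differentiable ℂ F → IntervalIntegrable (fun x : ℝ =>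
      Complex.exp (-(2 * Real.pi * Complex.I * n * x)) * F x) MeasureTheory.volume 0 1 := by
    intro F hF
    refine Continuous.intervalIntegrable ?_ _ _
    have := hF.continuous
    fun_prop
  rw [fourierIntegral, fourierIntegral, fourierIntegral, ← intervalIntegral.integral_const_mul,
    ← intervalIntegral.integral_sub (hi hF) ((hi hG).const_mul c)]
  congr 1
  ext x
  ring

/-- An entire doubly periodic function is constant. -/
theorem exists_eq_const_of_periodic {τ : ℂ} (hτ : 0 < τ.im) {F : ℂ → ℂ}
    (hF : Differentiable ℂ F) (hp : ∀ z, F (z + 1) = F z) (hq : ∀ z, F (z + τ) = F z) :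
    ∃ c, ∀ z, F z = c := by
  have hone : fourierIntegral (fun _ => 1) 0 = 1 := by simp [fourierIntegral]
  refine ⟨fourierIntegral F 0, fun z => ?_⟩
  have hG : Differentiable ℂ (fun z => F z - fourierIntegral F 0 * 1) := by fun_prop
  have := eq_zero_of_fourierIntegral hG (by simp [hp]) (fun n => ?_) z
  · linear_combination this
  rcases eq_or_ne n 0 with rfl | hn
  · rw [fourierIntegral_sub_const_mul hF (differentiable_const 1), hone]
    ring
  · have h := fourierIntegral_shift (τ := τ) (A := 1) (k := 0) hG (by simp [hp]) (by simp [hq]) n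
    rw [one_mul, add_zero] at h
    -- The shift multiplies the `n`-th coefficient by a number of modulus `exp (2πn Im τ) ≠ 1`, so
    -- that coefficient vanishes.
    have hne : Complex.exp (-(2 * Real.pi * Complex.I * n * τ)) ≠ 1 := by
      intro h1
      have h2 : ‖Complex.exp (-(2 * Real.pi * Complex.I * n * τ))‖ = 1 := by rw [h1]; simp
      rw [Complex.norm_exp, Real.exp_eq_one_iff] at h2
      have h3 : (-(2 * Real.pi * Complex.I * n * τ)).re = 2 * Real.pi * n * τ.im := by
        simp
      rw [h3] at h2
      simp [Real.pi_ne_zero, hn, hτ.ne'] at h2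
    by_contra h0
    exact hne (mul_right_cancel₀ h0 (by rw [one_mul]; exact h.symm))

/-- Entire functions with the quasi-periodicity of a theta function of order one form a space of
dimension at most one. -/
theorem exists_eq_const_mul {τ A : ℂ} (hA : A ≠ 0) {F G : ℂ → ℂ} (hF : Differentiable ℂ F)
    (hG : Differentiable ℂ G) (hFp : ∀ z, F (z + 1) = F z) (hGp : ∀ z, G (z + 1) = G z)
    (hFq : ∀ z, F (z + τ) = A * Complex.exp (-(2 * Real.pi * Complex.I * z)) * F z)
    (hGq : ∀ z, G (z + τ) = A * Complex.exp (-(2 * Real.pi * Complex.I * z)) * G z)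
    (hG0 : ∃ z, G z ≠ 0) : ∃ c, ∀ z, F z = c * G z := by
  -- With `k = 1` consecutive coefficients are proportional with nonzero ratio, so the zeroth
  -- coefficient determines all the others.
  have key : ∀ {H : ℂ → ℂ}, Differentiable ℂ H → (∀ z, H (z + 1) = H z) →
      (∀ z, H (z + τ) = A * Complex.exp (-(2 * Real.pi * Complex.I * z)) * H z) →
      fourierIntegral H 0 = 0 → ∀ z, H z = 0 := by
    intro H hH hp hq h0
    refine eq_zero_of_fourierIntegral hH hp fun n => ?_
    have hs := fourierIntegral_shift (k := 1) hH hp (by simpa using hq)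
    induction n using Int.induction_on with
    | zero => exact h0
    | succ i ih =>
      have := hs i
      rw [ih] at this
      simpa [hA] using this.symm
    | pred i ih =>
      have := hs (-i - 1)
      rw [sub_add_cancel, ih] at this
      simpa using this
  have hG1 : fourierIntegral G 0 ≠ 0 := by
    intro h
    obtain ⟨z, hz⟩ := hG0
    exact hz (key hG hGp hGq h z)
  refine ⟨fourierIntegral F 0 / fourierIntegral G 0, fun z => ?_⟩
  refine sub_eq_zero.mp (key (H := fun z => F z - fourierIntegral F 0 / fourierIntegral G 0 * G z)
    (by fun_prop) (by simp [hFp, hGp]) (fun z => ?_) ?_ z)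
  · rw [hFq, hGq]
    ring
  · rw [fourierIntegral_sub_const_mul hF hG]
    field_simp
    ring

/-! ### Removable singularities -/

/-- `F` agrees near `p`, except possibly at `p`, with a function analytic at `p`. -/
def Removable (F : ℂ → ℂ) (p : ℂ) : Prop :=
  ∃ g : ℂ → ℂ, AnalyticAt ℂ g p ∧ F =ᶠ[𝓝[≠] p] g

theorem Removable.of_analyticAt {F : ℂ → ℂ} {p : ℂ} (h : AnalyticAt ℂ F p) : Removable F p :=
  ⟨F, h, EventuallyEq.rfl⟩

theorem Removable.congr {F G : ℂ → ℂ} {p : ℂ} (h : Removable F p) (hFG : F =ᶠ[𝓝[≠] p] G) :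
    Removable G p := by
  obtain ⟨g, hg, hg'⟩ := h
  exact ⟨g, hg, hFG.symm.trans hg'⟩

theorem Removable.add {F G : ℂ → ℂ} {p : ℂ} (hF : Removable F p) (hG : Removable G p) :
    Removable (fun z => F z + G z) p := by
  obtain ⟨f, hf, hf'⟩ := hF
  obtain ⟨g, hg, hg'⟩ := hG
  refine ⟨fun z => f z + g z, hf.add hg, ?_⟩
  filter_upwards [hf', hg'] with z h1 h2
  rw [h1, h2]

theorem analyticAt_dslope {g : ℂ → ℂ} {p : ℂ} (hg : AnalyticAt ℂ g p) :
    AnalyticAt ℂ (dslope g p) p := by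
  rw [Complex.analyticAt_iff_eventually_differentiableAt] at hg
  obtain ⟨s, hs, hso, hps⟩ := eventually_nhds_iff.mp hg
  have hd : DifferentiableOn ℂ (dslope g p) s :=
    (Complex.differentiableOn_dslope (hso.mem_nhds hps)).mpr
      fun z hz => (hs z hz).differentiableWithinAt
  exact hd.analyticAt (hso.mem_nhds hps)

theorem Removable.div_sub {N : ℂ → ℂ} {p : ℂ} (hN : AnalyticAt ℂ N p) (h0 : N p = 0) :
    Removable (fun z => N z / (z - p)) p := by
  refine ⟨dslope N p, analyticAt_dslope hN, ?_⟩
  filter_upwards [self_mem_nhdsWithin] with z hz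
  rw [dslope_of_ne _ hz, slope_def_field, h0, sub_zero]

theorem Removable.div_sub_sq {N : ℂ → ℂ} {p : ℂ} (hN : AnalyticAt ℂ N p) (h0 : N p = 0)
    (h1 : deriv N p = 0) : Removable (fun z => N z / (z - p) ^ 2) p := by
  have := Removable.div_sub (analyticAt_dslope hN) (by rw [dslope_same, h1])
  refine this.congr ?_
  filter_upwards [self_mem_nhdsWithin] with z hz
  rw [dslope_of_ne _ hz, slope_def_field, h0, sub_zero]
  field_simp

theorem tendsto_add_nhdsNE (p s : ℂ) : Tendsto (fun z => z + s) (𝓝[≠] p) (𝓝[≠] (p + s)) := by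
  refine tendsto_nhdsWithin_of_tendsto_nhds_of_eventually_within _ ?_ ?_
  · exact ((continuous_add_const s).tendsto p).mono_left nhdsWithin_le_nhds
  · filter_upwards [self_mem_nhdsWithin] with z hz
    simpa using hz

theorem Removable.of_add {F : ℂ → ℂ} {p s : ℂ} (h : Removable (fun z => F (z + s)) p) :
    Removable F (p + s) := by
  obtain ⟨g, hg, hg'⟩ := h
  refine ⟨fun z => g (z - s), ?_, ?_⟩
  · exact AnalyticAt.fun_comp (by simpa using hg) (by fun_prop)
  · have := tendsto_add_nhdsNE (p + s) (-s)
    rw [add_neg_cancel_right] at this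
    have := this.eventually hg'
    filter_upwards [this] with z hz
    simpa [sub_eq_add_neg] using hz

theorem eq_of_eventuallyEq_nhdsNE {f g : ℂ → ℂ} {p : ℂ} (hf : ContinuousAt f p)
    (hg : ContinuousAt g p) (h : f =ᶠ[𝓝[≠] p] g) : f p = g p :=
  ((hf.eventuallyEq_nhds_iff_eventuallyEq_nhdsNE hg).mp h).eq_of_nhds

/-- Glue the local extensions by taking, at each `p`, the value of the one chosen at `p`. Near `p`
any two of them agree by continuity, since both equal `F` off isolated points. -/
theorem exists_entire_extension {F : ℂ → ℂ} (hF : ∀ p, Removable F p) :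
    ∃ H : ℂ → ℂ, Differentiable ℂ H ∧ ∀ p, F =ᶠ[𝓝[≠] p] H := by
  choose g hg hFg using hF
  have key : ∀ p, ∀ᶠ q in 𝓝 p, g q q = g p q := by
    intro p
    have h1 : ∀ᶠ q in 𝓝 p, q ≠ p → F q = g p q := eventually_nhdsWithin_iff.mp (hFg p)
    filter_upwards [h1.eventually_nhds, (hg p).eventually_analyticAt] with q hq hq'
    rcases eq_or_ne q p with rfl | hne
    · rfl
    refine eq_of_eventuallyEq_nhdsNE (hg q).continuousAt hq'.continuousAt ?_
    filter_upwards [hFg q, nhdsWithin_le_nhds hq,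
      nhdsWithin_le_nhds (isOpen_ne.mem_nhds hne)] with z h2 h3 h4
    rw [← h2, h3 h4]
  refine ⟨fun p => g p p, fun p => ?_, fun p => ?_⟩
  · exact ((hg p).congr (EventuallyEq.symm (key p))).differentiableAt
  · filter_upwards [hFg p, nhdsWithin_le_nhds (key p)] with z h1 h2
    rw [h1, h2]

/-! ### The Weierstrass zeta function -/

section Zeta

variable (L : PeriodPair)

/-- The Weierstrass zeta function with the `l₀`-term missing. -/
noncomputable def zetaExcept (l₀ z : ℂ) : ℂ :=
  ∑' l : L.lattice, if l.1 = l₀ then 0 else (1 / (z - l) + 1 / (l : ℂ) + z / (l : ℂ) ^ 2)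

/-- The three fractions combine to `s² / ((s - l) l²)`, which decays like `‖l‖⁻³`; this is summable
over a lattice of rank two. -/
theorem norm_zeta_term_le {r : ℝ} {s l : ℂ} (hr : 0 < r) (hs : ‖s‖ < r) (h : 2 * r ≤ ‖l‖) :
    ‖1 / (s - l) + 1 / l + s / l ^ 2‖ ≤ 2 * r ^ 2 * ‖l‖ ^ (-3 : ℝ) := by
  have hne : s - l ≠ 0 := by
    rw [sub_ne_zero]
    rintro rfl
    linarith
  have hl : 0 < ‖l‖ := by linarith
  have hl0 : l ≠ 0 := norm_pos_iff.mp hl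
  have hsl : ‖l‖ / 2 ≤ ‖s - l‖ := by
    rw [norm_sub_rev]
    exact .trans (by linarith) (norm_sub_norm_le l s)
  calc ‖1 / (s - l) + 1 / l + s / l ^ 2‖ = ‖s ^ 2 / ((s - l) * l ^ 2)‖ := by
        congr 1
        field_simp
        ring
    _ = ‖s‖ ^ 2 / (‖s - l‖ * ‖l‖ ^ 2) := by simp
    _ ≤ r ^ 2 / ((‖l‖ / 2) * ‖l‖ ^ 2) := by gcongr
    _ = 2 * r ^ 2 / ‖l‖ ^ 3 := by field_simp
    _ = _ := by
      rw [div_eq_mul_inv]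
      norm_cast

theorem hasSumLocallyUniformly_zetaExcept (l₀ : ℂ) :
    HasSumLocallyUniformly (fun (l : L.lattice) (z : ℂ) =>
      if l.1 = l₀ then 0 else (1 / (z - l) + 1 / (l : ℂ) + z / (l : ℂ) ^ 2))
      (zetaExcept L l₀) := by
  refine L.hasSumLocallyUniformly_aux (u := fun r l => 2 * r ^ 2 * ‖l‖ ^ (-3 : ℝ)) _
    (fun _ _ => (ZLattice.summable_norm_rpow _ _ (by simp; norm_num)).mul_left _) fun r hr =>
    Filter.eventually_atTop.mpr ⟨2 * r, ?_⟩
  rintro _ h s hs l rfl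
  split_ifs
  · rw [norm_zero]
    positivity
  · exact norm_zeta_term_le hr hs h

theorem zeta_term_differentiableOn (l₀ : ℂ) (l : L.lattice) :
    DifferentiableOn ℂ (fun z : ℂ =>
      if l.1 = l₀ then 0 else (1 / (z - l) + 1 / (l : ℂ) + z / (l : ℂ) ^ 2))
      (L.lattice \ {l₀})ᶜ := by
  split_ifs with hl
  · simp
  · refine .add (.add (.div (by fun_prop) (by fun_prop) fun x hx => ?_) (by fun_prop)) (by fun_prop)
    have : x ≠ l := by
      rintro rfl
      simp_all
    simpa [sub_eq_zero]

theorem differentiableOn_zetaExcept (l₀ : ℂ) :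
    DifferentiableOn ℂ (zetaExcept L l₀) (L.lattice \ {l₀})ᶜ :=
  (hasSumLocallyUniformly_zetaExcept L l₀).hasSumLocallyUniformlyOn.differentiableOn
    (.of_forall fun _ => .fun_sum fun l _ => zeta_term_differentiableOn L l₀ l)
    L.isOpen_compl_lattice_sdiff

theorem analyticAt_zetaExcept (l₀ : ℂ) : AnalyticAt ℂ (zetaExcept L l₀) l₀ :=
  (differentiableOn_zetaExcept L l₀).analyticAt (L.compl_lattice_sdiff_singleton_mem_nhds l₀)

/-- Locally uniform convergence of holomorphic partial sums permits termwise differentiation. -/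
theorem deriv_zetaExcept (l₀ : ℂ) {z : ℂ} (hz : z ∈ ((L.lattice \ {l₀})ᶜ : Set ℂ)) :
    deriv (zetaExcept L l₀) z = -L.weierstrassPExcept l₀ z := by
  have h1 := (hasSumLocallyUniformly_zetaExcept L l₀).tendstoLocallyUniformlyOn.deriv
    (.of_forall fun _ => .fun_sum fun l _ => zeta_term_differentiableOn L l₀ l)
    L.isOpen_compl_lattice_sdiff
  have h2 := (h1.tendsto_at hz).neg
  have h3 := L.hasSum_weierstrassPExcept l₀ z
  rw [← tendsto_nhds_unique h2 (h3.congr fun s => ?_), neg_neg]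
  have hd : ∀ l : L.lattice, DifferentiableAt ℂ (fun z : ℂ =>
      if l.1 = l₀ then 0 else (1 / (z - l) + 1 / (l : ℂ) + z / (l : ℂ) ^ 2)) z := fun l =>
    (zeta_term_differentiableOn L l₀ l).differentiableAt (L.isOpen_compl_lattice_sdiff.mem_nhds hz)
  simp only [Function.comp_apply]
  rw [deriv_fun_sum fun l _ => hd l, ← Finset.sum_neg_distrib]
  refine Finset.sum_congr rfl fun l _ => ?_
  split_ifs with hl
  · simp
  have hzl : z - l ≠ 0 := fun e => hl (by
    obtain rfl := sub_eq_zero.mp e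
    simpa using hz)
  have : HasDerivAt (fun z : ℂ => 1 / (z - l) + 1 / (l : ℂ) + z / (l : ℂ) ^ 2)
      (-1 / (z - l) ^ 2 + 1 / (l : ℂ) ^ 2) z := by
    have := ((((hasDerivAt_id z).sub_const (l : ℂ)).inv hzl).add_const (1 / (l : ℂ))).add
      ((hasDerivAt_id z).div_const ((l : ℂ) ^ 2))
    exact this.congr_of_eventuallyEq (Eventually.of_forall fun w => by simp)
  rw [this.deriv]
  ring

theorem weierstrassZeta_eq_zetaExcept_zero (z : ℂ) :
    weierstrassZeta L z = zetaExcept L 0 z + 1 / z := by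
  rw [weierstrassZeta, zetaExcept, add_comm]
  congr 1
  have := tsum_subtype {l : L.lattice | l ≠ 0}
    (fun l => 1 / (z - (l : ℂ)) + 1 / (l : ℂ) + z / (l : ℂ) ^ 2)
  refine this.trans (tsum_congr fun l => ?_)
  by_cases hl : l = 0
  · simp [hl]
  · have : (l : ℂ) ≠ 0 := by simpa using hl
    simp [hl]

theorem zetaExcept_add (l₀ : L.lattice) (z : ℂ) :
    zetaExcept L l₀ z + (1 / (z - l₀) + 1 / (l₀ : ℂ) + z / (l₀ : ℂ) ^ 2)
      = weierstrassZeta L z := by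
  -- Since `1 / 0 = 0`, the unrestricted series makes sense: its `l = 0` term is just `1 / z`. Every
  -- choice of `l₀` thus yields the same sum.
  have key : ∀ l₀ : L.lattice, HasSum (fun l : L.lattice =>
      1 / (z - (l : ℂ)) + 1 / (l : ℂ) + z / (l : ℂ) ^ 2)
      (zetaExcept L l₀ z + (1 / (z - l₀) + 1 / (l₀ : ℂ) + z / (l₀ : ℂ) ^ 2)) := by
    intro l₀
    have h1 := (hasSumLocallyUniformly_zetaExcept L l₀).hasSum (x := z)
    have h2 := hasSum_ite_eq l₀ (1 / (z - l₀) + 1 / (l₀ : ℂ) + z / (l₀ : ℂ) ^ 2)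
    refine (h1.add h2).congr_fun fun l => ?_
    by_cases hl : l = l₀
    · simp [hl]
    · have : (l : ℂ) ≠ l₀ := by simpa using hl
      simp [hl]
  rw [(key l₀).unique (key 0), weierstrassZeta_eq_zetaExcept_zero]
  simp

theorem exists_zeta_eq_add {l : ℂ} (hl : l ∈ L.lattice) :
    ∃ g : ℂ → ℂ, AnalyticAt ℂ g l ∧ ∀ z, weierstrassZeta L z = 1 / (z - l) + g z := by
  refine ⟨fun z => zetaExcept L l z + 1 / l + z / l ^ 2, ?_, fun z => ?_⟩
  · have := analyticAt_zetaExcept L l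
    fun_prop
  · rw [← zetaExcept_add L ⟨l, hl⟩]
    ring

theorem hasDerivAt_weierstrassZeta {z : ℂ} (hz : z ∉ L.lattice) :
    HasDerivAt (weierstrassZeta L) (-L.weierstrassP z) z := by
  have hz0 : z ≠ 0 := by
    rintro rfl
    exact hz (zero_mem _)
  have hzm : z ∈ ((L.lattice \ {0})ᶜ : Set ℂ) := by simp [hz]
  have h1 : HasDerivAt (zetaExcept L 0) (-L.weierstrassPExcept 0 z) z := by
    rw [← deriv_zetaExcept L 0 hzm]
    exact ((differentiableOn_zetaExcept L 0).differentiableAt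
      (L.isOpen_compl_lattice_sdiff.mem_nhds hzm)).hasDerivAt
  have h2 := h1.add (hasDerivAt_inv hz0)
  have h3 := L.weierstrassPExcept_add 0 z
  refine (h2.congr_deriv ?_).congr_of_eventuallyEq (Eventually.of_forall fun w => ?_)
  · rw [← h3]
    simp
    ring
  · rw [weierstrassZeta_eq_zetaExcept_zero]
    simp

theorem analyticAt_weierstrassZeta {z : ℂ} (hz : z ∉ L.lattice) :
    AnalyticAt ℂ (weierstrassZeta L) z := by
  have : DifferentiableOn ℂ (weierstrassZeta L) (L.lattice : Set ℂ)ᶜ := fun w hw =>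
    (hasDerivAt_weierstrassZeta L hw).differentiableAt.differentiableWithinAt
  exact this.analyticAt (L.isClosed_lattice.isOpen_compl.mem_nhds hz)

theorem weierstrassZeta_neg (z : ℂ) : weierstrassZeta L (-z) = -weierstrassZeta L z := by
  rw [weierstrassZeta_eq_zetaExcept_zero, weierstrassZeta_eq_zetaExcept_zero, neg_add]
  congr 1
  · rw [zetaExcept, zetaExcept, ← tsum_neg, ← (Equiv.neg L.lattice).tsum_eq]
    refine tsum_congr fun l => ?_
    by_cases hl : (l : ℂ) = 0
    · simp [hl]
    · simp only [Equiv.neg_apply, NegMemClass.coe_neg, neg_eq_zero, hl, if_false]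
      rw [show -z - -(l : ℂ) = -(z - l) by ring, div_neg, div_neg]
      ring
  · rw [div_neg]

theorem isPreconnected_compl_lattice : IsPreconnected ((L.lattice : Set ℂ)ᶜ) :=
  (Set.Countable.isConnected_compl_of_one_lt_rank (by simp)
    (countable_of_Lindelof_of_discrete (X := L.lattice))).2

/-- By periodicity of `℘` the difference has zero derivative, and the complement of the countable
lattice is connected. -/
theorem exists_weierstrassZeta_add {ω : ℂ} (hω : ω ∈ L.lattice) :
    ∃ c, ∀ z ∉ L.lattice, weierstrassZeta L (z + ω) = weierstrassZeta L z + c := by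
  have hadd : ∀ z ∉ L.lattice, z + ω ∉ L.lattice := fun z hz h =>
    hz (by simpa using sub_mem h hω)
  have hd : ∀ z ∉ L.lattice,
      HasDerivAt (fun z => weierstrassZeta L (z + ω) - weierstrassZeta L z) 0 z := by
    intro z hz
    have h1 := (hasDerivAt_weierstrassZeta L (hadd z hz)).comp_add_const z ω
    refine (h1.sub (hasDerivAt_weierstrassZeta L hz)).congr_deriv ?_
    rw [L.weierstrassP_add_coe z ⟨ω, hω⟩, sub_self]
  obtain ⟨c, hc⟩ := L.isClosed_lattice.isOpen_compl.exists_is_const_of_deriv_eq_zero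
    (isPreconnected_compl_lattice L)
    (fun z hz => (hd z hz).differentiableAt.differentiableWithinAt)
    (fun z hz => (hd z hz).deriv)
  exact ⟨c, fun z hz => by linear_combination hc z hz⟩

end Zeta

/-! ### Quasi-periodicity and uniqueness of `θ₁` -/

section Theta

variable {τ : ℂ}

theorem mem_lattice_iff (hτ : 0 < τ.im) {z : ℂ} :
    z ∈ (periods τ hτ).lattice ↔ ∃ m n : ℤ, m + n * τ = z := by
  simp [PeriodPair.mem_lattice, periods]

theorem one_mem_lattice (hτ : 0 < τ.im) : (1 : ℂ) ∈ (periods τ hτ).lattice :=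
  (mem_lattice_iff hτ).mpr ⟨1, 0, by simp⟩

theorem tau_mem_lattice (hτ : 0 < τ.im) : τ ∈ (periods τ hτ).lattice :=
  (mem_lattice_iff hτ).mpr ⟨0, 1, by simp⟩

theorem lattice_induction (hτ : 0 < τ.im) {P : ℂ → Prop} (h0 : P 0)
    (h1 : ∀ z, P z ↔ P (z + 1)) (h2 : ∀ z, P z ↔ P (z + τ)) {ω : ℂ}
    (hω : ω ∈ (periods τ hτ).lattice) : P ω := by
  obtain ⟨m, n, rfl⟩ := (mem_lattice_iff hτ).mp hω
  clear hω
  have hm : ∀ m : ℤ, P m := by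
    intro m
    induction m using Int.induction_on with
    | zero => simpa using h0
    | succ i ih => simpa using (h1 _).mp ih
    | pred i ih => exact (h1 _).mpr (by simpa using ih)
  induction n using Int.induction_on with
  | zero => simpa using hm m
  | succ i ih =>
    have := (h2 _).mp ih
    convert this using 1
    push_cast
    ring
  | pred i ih =>
    refine (h2 _).mpr ?_
    convert ih using 1
    push_cast
    ring

theorem theta₁_eq_jacobiTheta₂ (z : ℂ) :
    theta₁ τ z = -Complex.exp (Real.pi * Complex.I * (z + 1 / 2) + Real.pi * Complex.I * τ / 4)
      * jacobiTheta₂ (z + 1 / 2 + τ / 2) τ := by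
  rw [theta₁, jacobiTheta₂, neg_mul, ← tsum_mul_left]
  congr 1
  refine tsum_congr fun n => ?_
  rw [jacobiTheta₂_term, ← Complex.exp_add]
  congr 1
  ring

theorem differentiable_theta₁ (hτ : 0 < τ.im) : Differentiable ℂ (theta₁ τ) := by
  have h : Differentiable ℂ (fun z => jacobiTheta₂ z τ) := fun z =>
    differentiableAt_jacobiTheta₂_fst z hτ
  have h2 : Differentiable ℂ (fun z => jacobiTheta₂ (z + 1 / 2 + τ / 2) τ) :=
    h.comp (by fun_prop : Differentiable ℂ fun z : ℂ => z + 1 / 2 + τ / 2)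
  rw [funext (theta₁_eq_jacobiTheta₂ (τ := τ))]
  fun_prop

theorem theta₁_add_one (z : ℂ) : theta₁ τ (z + 1) = -theta₁ τ z := by
  rw [theta₁_eq_jacobiTheta₂, theta₁_eq_jacobiTheta₂,
    show z + 1 + 1 / 2 + τ / 2 = z + 1 / 2 + τ / 2 + 1 by ring, jacobiTheta₂_add_left,
    show Real.pi * Complex.I * (z + 1 + 1 / 2) + Real.pi * Complex.I * τ / 4
      = (Real.pi * Complex.I * (z + 1 / 2) + Real.pi * Complex.I * τ / 4)
        + Real.pi * Complex.I by ring, Complex.exp_add, Complex.exp_pi_mul_I]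
  ring

theorem theta₁_add_tau (z : ℂ) : theta₁ τ (z + τ)
    = -Complex.exp (-(Real.pi * Complex.I * τ)) * Complex.exp (-(2 * Real.pi * Complex.I * z))
      * theta₁ τ z := by
  rw [theta₁_eq_jacobiTheta₂, theta₁_eq_jacobiTheta₂,
    show z + τ + 1 / 2 + τ / 2 = z + 1 / 2 + τ / 2 + τ by ring, jacobiTheta₂_add_left']
  have hpi : Complex.exp (-(Real.pi * Complex.I)) = -1 := by
    rw [Complex.exp_neg, Complex.exp_pi_mul_I, inv_neg_one]
  have e : Complex.exp (Real.pi * Complex.I * (z + τ + 1 / 2) + Real.pi * Complex.I * τ / 4)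
      * Complex.exp (-Real.pi * Complex.I * (τ + 2 * (z + 1 / 2 + τ / 2)))
      = -(Complex.exp (-(Real.pi * Complex.I * τ)) * Complex.exp (-(2 * Real.pi * Complex.I * z))
        * Complex.exp (Real.pi * Complex.I * (z + 1 / 2) + Real.pi * Complex.I * τ / 4)) := by
    rw [← Complex.exp_add, ← Complex.exp_add, ← Complex.exp_add, ← mul_neg_one (Complex.exp _),
      ← hpi, ← Complex.exp_add]
    congr 1
    ring
  linear_combination (-jacobiTheta₂ (z + 1 / 2 + τ / 2) τ) * e

theorem theta₁_neg (z : ℂ) : theta₁ τ (-z) = -theta₁ τ z := by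
  -- The substitution `n ↦ -n - 1` changes the sign of `n + 1/2`; the offset `1/2` added to `z` then
  -- leaves the factor `exp (2πi(n + 1/2)) = -1`.
  rw [theta₁, theta₁, ← tsum_neg, ← ((Equiv.neg ℤ).trans (Equiv.addRight (-1))).tsum_eq,
    ← tsum_neg, ← tsum_neg]
  refine tsum_congr fun n => ?_
  simp only [Equiv.trans_apply, Equiv.neg_apply, Equiv.coe_addRight]
  have : Complex.exp (2 * Real.pi * Complex.I * (n + 1 / 2)) = -1 := by
    rw [show 2 * Real.pi * Complex.I * (n + 1 / 2)
      = Real.pi * Complex.I + n * (2 * Real.pi * Complex.I) by ring, Complex.exp_add,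
      Complex.exp_int_mul_two_pi_mul_I, Complex.exp_pi_mul_I, mul_one]
  rw [neg_neg, ← mul_neg_one (Complex.exp _), ← this, ← Complex.exp_add]
  congr 1
  push_cast
  ring

theorem theta₁_zero : theta₁ τ 0 = 0 := by
  have := theta₁_neg (τ := τ) 0
  rw [neg_zero] at this
  exact self_eq_neg.mp this

theorem integral_jacobiTheta₂_term (n : ℤ) :
    ∫ x : ℝ in (0 : ℝ)..1, jacobiTheta₂_term n x τ = if n = 0 then 1 else 0 := by
  split_ifs with hn
  · simp [hn, jacobiTheta₂_term]
  · have hc : 2 * Real.pi * Complex.I * n ≠ 0 := by simp [Real.pi_ne_zero, hn]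
    simp only [jacobiTheta₂_term, Complex.exp_add]
    rw [intervalIntegral.integral_mul_const, integral_exp_mul_complex hc]
    have : Complex.exp (2 * Real.pi * Complex.I * n) = 1 := by
      rw [mul_comm, Complex.exp_int_mul_two_pi_mul_I]
    simp [this]

/-- Only the `n = 0` term survives integration. This serves to show that `θ₁` is not identically
zero. -/
theorem integral_jacobiTheta₂ (hτ : 0 < τ.im) :
    ∫ x : ℝ in (0 : ℝ)..1, jacobiTheta₂ x τ = 1 := by
  have h := intervalIntegral.hasSum_integral_of_dominated_convergence
    (μ := MeasureTheory.volume) (a := 0) (b := 1)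
    (F := fun (n : ℤ) (x : ℝ) => jacobiTheta₂_term n x τ) (f := fun x : ℝ => jacobiTheta₂ x τ)
    (fun n _ => ‖jacobiTheta₂_term n 0 τ‖)
    (fun n => by
      refine Continuous.aestronglyMeasurable ?_
      unfold jacobiTheta₂_term
      fun_prop)
    (fun n => Eventually.of_forall fun x _ => by simp [norm_jacobiTheta₂_term])
    (Eventually.of_forall fun x _ => ((summable_jacobiTheta₂_term_iff 0 τ).mpr hτ).norm)
    (by simp)
    (Eventually.of_forall fun x _ => hasSum_jacobiTheta₂_term _ hτ)
  simp only [integral_jacobiTheta₂_term] at h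
  exact h.unique (hasSum_ite_eq 0 1)

theorem exists_theta₁_ne_zero (hτ : 0 < τ.im) : ∃ z, theta₁ τ z ≠ 0 := by
  by_contra! h
  have h0 : ∀ z, jacobiTheta₂ z τ = 0 := by
    intro z
    have := h (z - 1 / 2 - τ / 2)
    rw [theta₁_eq_jacobiTheta₂, show z - 1 / 2 - τ / 2 + 1 / 2 + τ / 2 = z by ring] at this
    simpa using this
  have := integral_jacobiTheta₂ hτ
  simp [h0] at this

/-- Up to a constant factor, `θ₁` is the only entire function with its quasi-periodicity. -/
theorem exists_eq_const_mul_theta₁ (hτ : 0 < τ.im) {F : ℂ → ℂ} (hF : Differentiable ℂ F)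
    (h1 : ∀ z, F (z + 1) = -F z)
    (h2 : ∀ z, F (z + τ) = -Complex.exp (-(Real.pi * Complex.I * τ))
      * Complex.exp (-(2 * Real.pi * Complex.I * z)) * F z) : ∃ c, ∀ z, F z = c * theta₁ τ z := by
  have hf := differentiable_theta₁ hτ
  have e1 : ∀ z, Complex.exp (Real.pi * Complex.I * (z + 1))
      = -Complex.exp (Real.pi * Complex.I * z) := by
    intro z
    rw [mul_add, mul_one, Complex.exp_add, Complex.exp_pi_mul_I, mul_neg_one]
  have e2 : ∀ z, Complex.exp (Real.pi * Complex.I * (z + τ))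
      = Complex.exp (Real.pi * Complex.I * τ) * Complex.exp (Real.pi * Complex.I * z) := by
    intro z
    rw [← Complex.exp_add]
    congr 1
    ring
  -- The factor `exp (πiz)` turns the sign under `z ↦ z + 1` into genuine periodicity; `A` absorbs
  -- its change under `z ↦ z + τ`.
  obtain ⟨c, hc⟩ := exists_eq_const_mul
    (F := fun z => Complex.exp (Real.pi * Complex.I * z) * F z)
    (G := fun z => Complex.exp (Real.pi * Complex.I * z) * theta₁ τ z) (τ := τ)
    (A := Complex.exp (Real.pi * Complex.I * τ) * -Complex.exp (-(Real.pi * Complex.I * τ)))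
    (by simp) (by fun_prop) (by fun_prop)
    (fun z => by rw [e1, h1, neg_mul_neg])
    (fun z => by rw [e1, theta₁_add_one, neg_mul_neg])
    (fun z => by rw [e2, h2]; ring)
    (fun z => by rw [e2, theta₁_add_tau]; ring)
    (by
      obtain ⟨z, hz⟩ := exists_theta₁_ne_zero hτ
      exact ⟨z, mul_ne_zero (Complex.exp_ne_zero _) hz⟩)
  refine ⟨c, fun z => mul_left_cancel₀ (Complex.exp_ne_zero (Real.pi * Complex.I * z)) ?_⟩
  rw [hc]
  ring

/-! ### Zeros of `θ₁` are exactly the lattice points, and are simple -/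

theorem theta₁_eq_zero_iff_add_one (z : ℂ) : theta₁ τ z = 0 ↔ theta₁ τ (z + 1) = 0 := by
  rw [theta₁_add_one, neg_eq_zero]

theorem theta₁_eq_zero_iff_add_tau (z : ℂ) : theta₁ τ z = 0 ↔ theta₁ τ (z + τ) = 0 := by
  rw [theta₁_add_tau]
  simp

theorem theta₁_add_eq_zero (hτ : 0 < τ.im) {a ω : ℂ} (ha : theta₁ τ a = 0)
    (hω : ω ∈ (periods τ hτ).lattice) : theta₁ τ (a + ω) = 0 := by
  refine lattice_induction hτ (P := fun ω => theta₁ τ (a + ω) = 0) (by simpa using ha)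
    (fun z => ?_) (fun z => ?_) hω
  · rw [theta₁_eq_zero_iff_add_one (a + z), add_assoc]
  · rw [theta₁_eq_zero_iff_add_tau (a + z), add_assoc]

theorem eventually_theta₁_ne_zero (hτ : 0 < τ.im) (p : ℂ) : ∀ᶠ z in 𝓝[≠] p, theta₁ τ z ≠ 0 := by
  have ha : AnalyticOnNhd ℂ (theta₁ τ) Set.univ := fun z _ =>
    (differentiable_theta₁ hτ).analyticAt z
  refine ((ha p trivial).eventually_eq_zero_or_eventually_ne_zero).resolve_left fun h => ?_
  obtain ⟨z, hz⟩ := exists_theta₁_ne_zero hτ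
  exact hz (ha.eqOn_zero_of_preconnected_of_eventuallyEq_zero isPreconnected_univ trivial h trivial)

/-- If `φ` is doubly periodic and every pole of `φ` is cancelled by a zero of `θ₁`, then `φ` is
constant. -/
theorem eventually_eq_const_of_removable_mul (hτ : 0 < τ.im) {φ : ℂ → ℂ}
    (h1 : ∀ p, ∀ᶠ z in 𝓝[≠] p, φ (z + 1) = φ z) (h2 : ∀ p, ∀ᶠ z in 𝓝[≠] p, φ (z + τ) = φ z)
    (hφ : ∀ p, Removable (fun z => theta₁ τ z * φ z) p) :
    ∃ c, ∀ p, ∀ᶠ z in 𝓝[≠] p, φ z = c := by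
  -- The extension of `θ₁ φ` inherits the multipliers of `θ₁`, so it equals `c θ₁`.
  obtain ⟨H, hH, hH'⟩ := exists_entire_extension hφ
  have shift : ∀ s p, ∀ᶠ z in 𝓝[≠] p, theta₁ τ (z + s) * φ (z + s) = H (z + s) := fun s p =>
    (tendsto_add_nhdsNE p s).eventually (hH' (p + s))
  have hHc := hH.continuous
  obtain ⟨c, hc⟩ := exists_eq_const_mul_theta₁ hτ hH
    (fun p => eq_of_eventuallyEq_nhdsNE (f := fun z => H (z + 1)) (g := fun z => -H z)
      (by fun_prop) (by fun_prop) (by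
        filter_upwards [shift 1 p, hH' p, h1 p] with z a1 a2 a3
        rw [← a1, ← a2, a3, theta₁_add_one, neg_mul]))
    (fun p => eq_of_eventuallyEq_nhdsNE (f := fun z => H (z + τ)) (g := fun z =>
        -Complex.exp (-(Real.pi * Complex.I * τ)) * Complex.exp (-(2 * Real.pi * Complex.I * z))
          * H z)
      (by fun_prop) (by fun_prop) (by
        filter_upwards [shift τ p, hH' p, h2 p] with z a1 a2 a3
        rw [← a1, ← a2, a3, theta₁_add_tau, mul_assoc]))
  refine ⟨c, fun p => ?_⟩
  filter_upwards [hH' p, eventually_theta₁_ne_zero hτ p] with z a1 a2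
  rw [hc, mul_comm] at a1
  exact mul_right_cancel₀ a2 a1

/-- A function with a genuine pole is not constant near it. -/
theorem false_of_eventually_eq_const {φ g : ℂ → ℂ} {c : ℂ} {n : ℕ} (hn : n ≠ 0)
    (h : ∀ᶠ z in 𝓝[≠] 0, φ z = c) (hg : ContinuousAt g 0) (hg0 : g 0 ≠ 0)
    (hφ : ∀ᶠ z in 𝓝[≠] 0, z ^ n * φ z = g z) : False := by
  refine hg0 ?_
  have := eq_of_eventuallyEq_nhdsNE (p := 0) (f := g) (g := fun z => z ^ n * c) hg
    (by fun_prop) (by filter_upwards [h, hφ] with z a1 a2; rw [← a2, a1])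
  simpa [hn] using this

theorem exists_weierstrassP_eq_add (L : PeriodPair) {l : ℂ} (hl : l ∈ L.lattice) :
    ∃ g : ℂ → ℂ, AnalyticAt ℂ g l ∧ ∀ z, L.weierstrassP z = 1 / (z - l) ^ 2 + g z := by
  refine ⟨fun z => L.weierstrassPExcept l z - 1 / l ^ 2, ?_, fun z => ?_⟩
  · exact (L.analyticAt_weierstrassPExcept l).sub analyticAt_const
  · rw [← L.weierstrassPExcept_add ⟨l, hl⟩]
    ring

theorem eventually_notMem_lattice (hτ : 0 < τ.im) (p : ℂ) :
    ∀ᶠ z in 𝓝[≠] p, z ∉ (periods τ hτ).lattice := by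
  have := nhdsWithin_le_nhds (s := {p}ᶜ)
    ((periods τ hτ).compl_lattice_sdiff_singleton_mem_nhds p)
  filter_upwards [this, self_mem_nhdsWithin] with z h1 h2 h3
  exact h1 ⟨h3, h2⟩

theorem Removable.theta₁_mul_pole (hτ : 0 < τ.im) {φ g : ℂ → ℂ} {p c : ℂ} (hp : theta₁ τ p = 0)
    (hg : AnalyticAt ℂ g p) (hφ : ∀ z, φ z = c / (z - p) + g z) :
    Removable (fun z => theta₁ τ z * φ z) p := by
  have hf := (differentiable_theta₁ hτ).analyticAt p
  refine (Removable.add (Removable.div_sub (N := fun z => c * theta₁ τ z) (by fun_prop)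
    (by simp [hp])) (Removable.of_analyticAt (hf.mul hg))).congr (Eventually.of_forall fun z => ?_)
  simp only [hφ, Pi.mul_apply]
  ring

/-- If `θ₁ a = 0` with `a` off the lattice, then `ζ(z - a) - ζ(z)` is elliptic with simple poles
only on the lattice and its translate by `a`, where `θ₁` vanishes. It would be constant, despite its
pole at `0`. -/
theorem theta₁_ne_zero (hτ : 0 < τ.im) {a : ℂ} (ha : a ∉ (periods τ hτ).lattice) :
    theta₁ τ a ≠ 0 := by
  intro h0
  set L := periods τ hτ with hL
  have hf := differentiable_theta₁ hτ
  -- The additive quasi-period of `ζ` cancels in the difference.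
  have hper : ∀ ω ∈ L.lattice, ∀ p, ∀ᶠ z in 𝓝[≠] p,
      weierstrassZeta L (z + ω - a) - weierstrassZeta L (z + ω)
        = weierstrassZeta L (z - a) - weierstrassZeta L z := by
    intro ω hω p
    obtain ⟨c, hc⟩ := exists_weierstrassZeta_add L hω
    filter_upwards [eventually_notMem_lattice hτ p,
      (tendsto_add_nhdsNE p (-a)).eventually (eventually_notMem_lattice hτ _)] with z h1 h2
    rw [hc z h1, show z + ω - a = z + -a + ω by ring, hc _ h2, sub_eq_add_neg z]
    ring
  obtain ⟨c, hc⟩ := eventually_eq_const_of_removable_mul hτ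
    (φ := fun z => weierstrassZeta L (z - a) - weierstrassZeta L z)
    (hper 1 (one_mem_lattice hτ)) (hper τ (tau_mem_lattice hτ)) (fun p => by
      have hshift : ∀ {g : ℂ → ℂ}, AnalyticAt ℂ g (p - a) →
          AnalyticAt ℂ (fun z => g (z - a)) p := fun hg => AnalyticAt.fun_comp hg (by fun_prop)
      by_cases h1 : p ∈ L.lattice
      · have h2 : p - a ∉ L.lattice := fun h => ha (by simpa using sub_mem h1 h)
        obtain ⟨g, hg, hg'⟩ := exists_zeta_eq_add L h1
        refine Removable.theta₁_mul_pole hτ (c := -1)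
          (g := fun z => weierstrassZeta L (z - a) - g z) ?_ ?_ fun z => ?_
        · simpa using theta₁_add_eq_zero hτ theta₁_zero h1
        · exact (hshift (analyticAt_weierstrassZeta L h2)).sub hg
        · rw [hg' z]
          ring
      by_cases h2 : p - a ∈ L.lattice
      · obtain ⟨g, hg, hg'⟩ := exists_zeta_eq_add L h2
        refine Removable.theta₁_mul_pole hτ (c := 1)
          (g := fun z => g (z - a) - weierstrassZeta L z) ?_ ?_ fun z => ?_
        · simpa using theta₁_add_eq_zero hτ h0 h2
        · exact (hshift hg).sub (analyticAt_weierstrassZeta L h1)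
        · rw [hg', sub_sub_sub_cancel_right]
          ring
      · exact Removable.of_analyticAt ((hf.analyticAt p).mul
          ((hshift (analyticAt_weierstrassZeta L h2)).sub (analyticAt_weierstrassZeta L h1))))
  obtain ⟨g, hg, hg'⟩ := exists_zeta_eq_add L (zero_mem L.lattice)
  have hma : ContinuousAt (fun z => weierstrassZeta L (z - a)) 0 := by
    have : AnalyticAt ℂ (weierstrassZeta L) (0 - a) :=
      analyticAt_weierstrassZeta L (by simpa using ha)
    exact ContinuousAt.comp' this.continuousAt (by fun_prop)
  have hgc := hg.continuousAt
  refine false_of_eventually_eq_const one_ne_zero (hc 0)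
    (g := fun z => z * (weierstrassZeta L (z - a) - g z) - 1) (by fun_prop) (by simp) ?_
  filter_upwards [self_mem_nhdsWithin] with z hz
  have hz' : z ≠ 0 := hz
  rw [hg' z, sub_zero]
  field_simp
  ring

theorem theta₁_eq_zero_of_mem (hτ : 0 < τ.im) {p : ℂ} (hp : p ∈ (periods τ hτ).lattice) :
    theta₁ τ p = 0 := by
  simpa using theta₁_add_eq_zero hτ theta₁_zero hp

theorem deriv_theta₁_add_one (z : ℂ) : deriv (theta₁ τ) (z + 1) = -deriv (theta₁ τ) z := by
  rw [← deriv_comp_add_const, funext (theta₁_add_one (τ := τ)), deriv.fun_neg]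

theorem deriv_theta₁_add_tau (hτ : 0 < τ.im) (z : ℂ) : deriv (theta₁ τ) (z + τ)
    = -Complex.exp (-(Real.pi * Complex.I * τ)) * Complex.exp (-(2 * Real.pi * Complex.I * z))
      * (deriv (theta₁ τ) z - 2 * Real.pi * Complex.I * theta₁ τ z) := by
  have h1 := (differentiable_theta₁ hτ z).hasDerivAt
  have h2 : HasDerivAt (fun z => Complex.exp (-(2 * Real.pi * Complex.I * z)))
      (Complex.exp (-(2 * Real.pi * Complex.I * z)) * -(2 * Real.pi * Complex.I * 1)) z :=
    (((hasDerivAt_id z).const_mul (2 * Real.pi * Complex.I)).neg).cexp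
  rw [← deriv_comp_add_const, funext (theta₁_add_tau (τ := τ))]
  refine ((h2.const_mul _).mul h1).deriv.trans ?_
  ring

theorem deriv_theta₁_eq_zero_iff (hτ : 0 < τ.im) {p : ℂ} (hp : p ∈ (periods τ hτ).lattice) :
    deriv (theta₁ τ) p = 0 ↔ deriv (theta₁ τ) 0 = 0 := by
  refine (lattice_induction hτ (P := fun p => theta₁ τ p = 0 ∧
    (deriv (theta₁ τ) p = 0 ↔ deriv (theta₁ τ) 0 = 0)) ⟨theta₁_zero, Iff.rfl⟩
    (fun z => ?_) (fun z => ?_) hp).2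
  · rw [← theta₁_eq_zero_iff_add_one, deriv_theta₁_add_one, neg_eq_zero]
  · rw [← theta₁_eq_zero_iff_add_tau, deriv_theta₁_add_tau hτ]
    refine and_congr_right fun hz => ?_
    rw [hz]
    simp

/-- Otherwise every lattice point is a zero of order at least two, which cancels the double poles of
`℘` and forces `℘` to be constant. -/
theorem deriv_theta₁_zero_ne_zero (hτ : 0 < τ.im) : deriv (theta₁ τ) 0 ≠ 0 := by
  intro h0
  set L := periods τ hτ with hL
  have hf := differentiable_theta₁ hτ
  have hper : ∀ ω ∈ L.lattice, ∀ z, L.weierstrassP (z + ω) = L.weierstrassP z := fun ω hω z =>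
    L.weierstrassP_add_coe z ⟨ω, hω⟩
  obtain ⟨c, hc⟩ := eventually_eq_const_of_removable_mul hτ (φ := L.weierstrassP)
    (fun p => Eventually.of_forall (hper 1 (one_mem_lattice hτ)))
    (fun p => Eventually.of_forall (hper τ (tau_mem_lattice hτ))) (fun p => by
      by_cases h1 : p ∈ L.lattice
      · obtain ⟨g, hg, hg'⟩ := exists_weierstrassP_eq_add L h1
        refine (Removable.add (Removable.div_sub_sq (hf.analyticAt p) 
          (theta₁_eq_zero_of_mem hτ h1) ((deriv_theta₁_eq_zero_iff hτ h1).mpr h0))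
          (Removable.of_analyticAt ((hf.analyticAt p).mul hg))).congr
          (Eventually.of_forall fun z => ?_)
        simp only [hg', Pi.mul_apply]
        ring
      · exact Removable.of_analyticAt ((hf.analyticAt p).mul (L.analyticOnNhd_weierstrassP p h1)))
  obtain ⟨g, hg, hg'⟩ := exists_weierstrassP_eq_add L (zero_mem L.lattice)
  have hgc := hg.continuousAt
  refine false_of_eventually_eq_const two_ne_zero (hc 0)
    (g := fun z => z ^ 2 * g z + 1) (by fun_prop) (by simp) ?_
  filter_upwards [self_mem_nhdsWithin] with z hz
  have hz' : z ≠ 0 := hz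
  rw [hg' z, sub_zero]
  field_simp
  ring

end Theta

/-! ### Product formula, three-term identity and Fay's identity -/

section Identities

variable {τ : ℂ}

theorem Removable.iff_of_periodic {F : ℂ → ℂ} {s : ℂ} (h : ∀ z, F (z + s) = F z) (p : ℂ) :
    Removable F p ↔ Removable F (p + s) := by
  refine ⟨fun hp => Removable.of_add (by simpa only [h] using hp), fun hp => ?_⟩
  have : Removable (fun z => F (z + -s)) (p + s) := by
    have e : (fun z => F (z + -s)) = F := by
      funext z
      rw [← h, neg_add_cancel_right]
    rwa [e]
  simpa using this.of_add

theorem deriv_zero_of_even {N : ℂ → ℂ} (h : ∀ z, N (-z) = N z) : deriv N 0 = 0 := by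
  have := deriv_comp_neg N 0
  rw [funext h, neg_zero] at this
  exact self_eq_neg.mp this

theorem sub_mul_dslope_theta₁ (hτ : 0 < τ.im) {p : ℂ} (hp : p ∈ (periods τ hτ).lattice) (z : ℂ) :
    (z - p) * dslope (theta₁ τ) p z = theta₁ τ z := by
  have := sub_smul_dslope (theta₁ τ) p z
  rwa [theta₁_eq_zero_of_mem hτ hp, sub_zero] at this

/-- The quotient is elliptic in `z`, even, and normalised to have principal part `1/z²` at `0`.
Subtracting `℘` leaves an entire elliptic function, hence a constant. -/
theorem theta₁_mul_theta₁_div_sq_eq (hτ : 0 < τ.im) {l z : ℂ}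
    (hl : l ∉ (periods τ hτ).lattice) (hz : z ∉ (periods τ hτ).lattice) :
    theta₁ τ (z - l) * theta₁ τ (z + l) * deriv (theta₁ τ) 0 ^ 2
        / (theta₁ τ l * theta₁ τ (-l)) / theta₁ τ z ^ 2
      = (periods τ hτ).weierstrassP z - (periods τ hτ).weierstrassP l := by
  set L := periods τ hτ with hL
  set K := deriv (theta₁ τ) 0 with hK
  have hK0 : K ≠ 0 := deriv_theta₁_zero_ne_zero hτ
  have hf := differentiable_theta₁ hτ
  have hl0 : theta₁ τ l ≠ 0 := theta₁_ne_zero hτ hl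
  have hl1 : theta₁ τ (-l) ≠ 0 := by rwa [theta₁_neg, neg_ne_zero]
  let D : ℂ → ℂ := fun z => theta₁ τ (z - l) * theta₁ τ (z + l) * K ^ 2
        / (theta₁ τ l * theta₁ τ (-l)) / theta₁ τ z ^ 2 - L.weierstrassP z
  have hD1 : ∀ z, D (z + 1) = D z := by
    intro z
    simp only [D]
    rw [show z + 1 - l = z - l + 1 by ring, show z + 1 + l = z + l + 1 by ring, theta₁_add_one,
      theta₁_add_one, theta₁_add_one, L.weierstrassP_add_coe z ⟨1, one_mem_lattice hτ⟩, neg_mul_neg,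
      neg_sq]
  have hD2 : ∀ z, D (z + τ) = D z := by
    intro z
    simp only [D]
    rw [show z + τ - l = z - l + τ by ring, show z + τ + l = z + l + τ by ring, theta₁_add_tau,
      theta₁_add_tau, theta₁_add_tau, L.weierstrassP_add_coe z ⟨τ, tau_mem_lattice hτ⟩]
    have e : Complex.exp (-(2 * Real.pi * Complex.I * (z - l)))
        * Complex.exp (-(2 * Real.pi * Complex.I * (z + l)))
        = Complex.exp (-(2 * Real.pi * Complex.I * z)) ^ 2 := by
      rw [sq, ← Complex.exp_add, ← Complex.exp_add]
      congr 1
      ring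
    have hE := Complex.exp_ne_zero (-(2 * Real.pi * Complex.I * z))
    have hA := Complex.exp_ne_zero (-(Real.pi * Complex.I * τ))
    generalize Complex.exp (-(2 * Real.pi * Complex.I * z)) = E at *
    generalize Complex.exp (-(Real.pi * Complex.I * τ)) = A at *
    generalize Complex.exp (-(2 * Real.pi * Complex.I * (z - l))) = E1 at *
    generalize Complex.exp (-(2 * Real.pi * Complex.I * (z + l))) = E2 at *
    congr 1
    rw [show -A * E1 * theta₁ τ (z - l) * (-A * E2 * theta₁ τ (z + l)) * K ^ 2
      = A ^ 2 * (E1 * E2) * (theta₁ τ (z - l) * theta₁ τ (z + l) * K ^ 2) by ring, e,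
      show (-A * E * theta₁ τ z) ^ 2 = A ^ 2 * E ^ 2 * theta₁ τ z ^ 2 by ring, mul_div_assoc,
      mul_div_mul_left _ _ (by positivity)]
  have hDa : ∀ p ∉ L.lattice, AnalyticAt ℂ D p := by
    intro p hp
    have h1 := L.analyticOnNhd_weierstrassP p hp
    have h2 : ∀ s, AnalyticAt ℂ (fun z => theta₁ τ (z + s)) p := fun s =>
      (by fun_prop : Differentiable ℂ fun z => theta₁ τ (z + s)).analyticAt p
    have h3 := hf.analyticAt p
    simp only [D, sub_eq_add_neg _ l]
    refine AnalyticAt.sub (AnalyticAt.div ?_ (by fun_prop) (pow_ne_zero _ (theta₁_ne_zero hτ hp))) h1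
    simp only [div_eq_mul_inv]
    exact (((h2 _).mul (h2 _)).mul analyticAt_const).mul analyticAt_const
  have hD0 : Removable D 0 := by
    set u := dslope (theta₁ τ) 0 with hu
    have hua : AnalyticAt ℂ u 0 := analyticAt_dslope (hf.analyticAt 0)
    have hu0 : u 0 = K := dslope_same _ _
    have hmul : ∀ z, z * u z = theta₁ τ z := fun z => by
      simpa using sub_mul_dslope_theta₁ hτ (zero_mem _) z
    have hueven : ∀ z, u (-z) = u z := by
      intro z
      rcases eq_or_ne z 0 with rfl | hz
      · rw [neg_zero]
      · refine mul_left_cancel₀ hz ?_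
        rw [hmul, ← neg_inj, ← theta₁_neg, ← hmul, neg_mul]
    -- With `θ₁ z = z u(z)`, the quotient minus `1/z²` is `N / z²`. The normalisation gives `N 0 =
    -- 0` and evenness gives `N' 0 = 0`, so the singularity is removable.
    let N : ℂ → ℂ := fun z => theta₁ τ (z - l) * theta₁ τ (z + l) * K ^ 2
        / (theta₁ τ l * theta₁ τ (-l)) / u z ^ 2 - 1
    have hNa : AnalyticAt ℂ N 0 := by
      have h2 : ∀ s, AnalyticAt ℂ (fun z => theta₁ τ (z + s)) 0 := fun s =>
        (by fun_prop : Differentiable ℂ fun z => theta₁ τ (z + s)).analyticAt 0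
      simp only [N, sub_eq_add_neg _ l]
      refine AnalyticAt.sub (AnalyticAt.div ?_ (by fun_prop) (by simp [hu0, hK0])) analyticAt_const
      simp only [div_eq_mul_inv]
      exact (((h2 _).mul (h2 _)).mul analyticAt_const).mul analyticAt_const
    have hN0 : N 0 = 0 := by
      simp only [N, hu0, zero_sub, zero_add]
      field_simp
      ring
    have hN1 : deriv N 0 = 0 := deriv_zero_of_even fun z => by
      simp only [N, hueven]
      rw [show -z - l = -(z + l) by ring, show -z + l = -(z - l) by ring, theta₁_neg, theta₁_neg]
      ring
    obtain ⟨g, hg, hg'⟩ := exists_weierstrassP_eq_add L (zero_mem L.lattice)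
    refine (Removable.add (Removable.div_sub_sq hNa hN0 hN1)
      (Removable.of_analyticAt hg.neg)).congr ?_
    filter_upwards [self_mem_nhdsWithin] with z hz
    have hz' : z ≠ 0 := hz
    simp only [N, D, hg', sub_zero, Pi.neg_apply, ← hmul z, mul_pow]
    rw [sub_div, div_div _ (u z ^ 2), mul_comm (u z ^ 2)]
    ring
  have hDr : ∀ p, Removable D p := by
    intro p
    by_cases hp : p ∈ L.lattice
    · exact lattice_induction hτ hD0 (Removable.iff_of_periodic hD1)
        (Removable.iff_of_periodic hD2) hp
    · exact Removable.of_analyticAt (hDa p hp)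
  obtain ⟨H, hH, hDH⟩ := exists_entire_extension hDr
  have hHs : ∀ s, (∀ z, D (z + s) = D z) → ∀ z, H (z + s) = H z := by
    intro s hs p
    have hHc := hH.continuous
    refine eq_of_eventuallyEq_nhdsNE (f := fun z => H (z + s)) (by fun_prop) (by fun_prop) ?_
    filter_upwards [(tendsto_add_nhdsNE p s).eventually (hDH (p + s)), hDH p] with z h1 h2
    rw [← h1, ← h2, hs]
  obtain ⟨c, hc⟩ := exists_eq_const_of_periodic hτ hH (hHs 1 hD1) (hHs τ hD2)
  have hval : ∀ p ∉ L.lattice, D p = c := fun p hp => by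
    rw [← hc p]
    exact eq_of_eventuallyEq_nhdsNE (hDa p hp).continuousAt hH.continuous.continuousAt (hDH p)
  have h1 := hval z hz
  -- At `z = l` the theta product vanishes, which identifies the constant as `-℘(l)`.
  have h2 := hval l hl
  simp only [D, sub_self, theta₁_zero, zero_mul, zero_div] at h2
  linear_combination h1 - h2

theorem theta₁_mul_theta₁_eq (hτ : 0 < τ.im) {x y : ℂ}
    (hx : x ∉ (periods τ hτ).lattice) (hy : y ∉ (periods τ hτ).lattice) :
    deriv (theta₁ τ) 0 ^ 2 * (theta₁ τ (x + y) * theta₁ τ (x - y)) = theta₁ τ x ^ 2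
      * theta₁ τ y ^ 2 * ((periods τ hτ).weierstrassP y - (periods τ hτ).weierstrassP x) := by
  have h := theta₁_mul_theta₁_div_sq_eq hτ hy hx
  have h1 := theta₁_ne_zero hτ hx
  have h2 := theta₁_ne_zero hτ hy
  rw [theta₁_neg] at h
  field_simp at h
  linear_combination -h

/-- Up to the factor `θ₁'(0)²`, `Q` is `θ₁² (℘(1/2) - ℘)`. Writing it as a theta product makes it
continuous everywhere, so the identity extends from generic `x`, `y` to all by continuity. -/
theorem exists_theta₁_add_mul_theta₁_sub (hτ : 0 < τ.im) : ∃ Q : ℂ → ℂ, ∀ x y,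
    theta₁ τ (x + y) * theta₁ τ (x - y) = Q x * theta₁ τ y ^ 2 - theta₁ τ x ^ 2 * Q y := by
  set L := periods τ hτ with hL
  have hf := (differentiable_theta₁ hτ).continuous
  have hK0 := deriv_theta₁_zero_ne_zero hτ
  have hc : (1 / 2 : ℂ) ∉ L.lattice := L.ω₁_div_two_notMem_lattice
  have hc0 := theta₁_ne_zero hτ hc
  let Q : ℂ → ℂ := fun z => theta₁ τ (z + 1 / 2) * theta₁ τ (z - 1 / 2) / theta₁ τ (1 / 2) ^ 2
  have hQc : Continuous Q := by fun_prop
  have hQ : ∀ z ∉ L.lattice, deriv (theta₁ τ) 0 ^ 2 * Q z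
      = theta₁ τ z ^ 2 * (L.weierstrassP (1 / 2) - L.weierstrassP z) := by
    intro z hz
    have := theta₁_mul_theta₁_eq hτ hz hc
    simp only [Q]
    rw [← mul_div_assoc, this, hL]
    field_simp
  have h1 : ∀ x ∉ L.lattice, ∀ y ∉ L.lattice, theta₁ τ (x + y) * theta₁ τ (x - y)
      = Q x * theta₁ τ y ^ 2 - theta₁ τ x ^ 2 * Q y := by
    intro x hx y hy
    refine mul_left_cancel₀ (pow_ne_zero 2 hK0) ?_
    linear_combination theta₁_mul_theta₁_eq hτ hx hy - theta₁ τ y ^ 2 * hQ x hx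
      + theta₁ τ x ^ 2 * hQ y hy
  have h2 : ∀ x, ∀ y ∉ L.lattice, theta₁ τ (x + y) * theta₁ τ (x - y)
      = Q x * theta₁ τ y ^ 2 - theta₁ τ x ^ 2 * Q y := by
    intro x y hy
    refine eq_of_eventuallyEq_nhdsNE (f := fun x => theta₁ τ (x + y) * theta₁ τ (x - y))
      (g := fun x => Q x * theta₁ τ y ^ 2 - theta₁ τ x ^ 2 * Q y) (by fun_prop) (by fun_prop) ?_
    filter_upwards [eventually_notMem_lattice hτ x] with x hx using h1 x hx y hy
  refine ⟨Q, fun x y => ?_⟩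
  refine eq_of_eventuallyEq_nhdsNE (f := fun y => theta₁ τ (x + y) * theta₁ τ (x - y))
    (g := fun y => Q x * theta₁ τ y ^ 2 - theta₁ τ x ^ 2 * Q y) (by fun_prop) (by fun_prop) ?_
  filter_upwards [eventually_notMem_lattice hτ y] with y hy using h2 x y hy

/-- Weierstrass' three-term identity. -/
theorem theta₁_three_term (hτ : 0 < τ.im) (x y u t : ℂ) :
    theta₁ τ (x + y) * theta₁ τ (x - y) * (theta₁ τ (u + t) * theta₁ τ (u - t))
      + theta₁ τ (x + u) * theta₁ τ (x - u) * (theta₁ τ (t + y) * theta₁ τ (t - y))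
      + theta₁ τ (x + t) * theta₁ τ (x - t) * (theta₁ τ (y + u) * theta₁ τ (y - u)) = 0 := by
  obtain ⟨Q, hQ⟩ := exists_theta₁_add_mul_theta₁_sub hτ
  -- Each product is now a `2 × 2` minor of the pairs `(Q, θ₁²)`, and the claim is the Plücker
  -- relation among four such pairs.
  simp only [hQ]
  ring

theorem sigma_fay (hτ : 0 < τ.im) {l m z w : ℂ} (hl : l ∉ (periods τ hτ).lattice)
    (hm : m ∉ (periods τ hτ).lattice) (hlm : l + m ∉ (periods τ hτ).lattice)
    (hz : z ∉ (periods τ hτ).lattice) (hw : w ∉ (periods τ hτ).lattice)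
    (hzw : z - w ∉ (periods τ hτ).lattice) :
    sigma τ l z * sigma τ m w - sigma τ (l + m) w * sigma τ l (z - w)
      - sigma τ m (w - z) * sigma τ (l + m) z = 0 := by
  -- The half-sums are chosen so that the sums and differences are, up to sign, the twelve theta
  -- arguments left after clearing denominators.
  have h := theta₁_three_term hτ ((z - l + w - m) / 2) ((z - l - w + m) / 2)
    ((l + m + z - w) / 2) ((l + m - z + w) / 2)
  rw [show (z - l + w - m) / 2 + (z - l - w + m) / 2 = z - l by ring,
    show (z - l + w - m) / 2 - (z - l - w + m) / 2 = w - m by ring,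
    show (l + m + z - w) / 2 + (l + m - z + w) / 2 = l + m by ring,
    show (l + m + z - w) / 2 - (l + m - z + w) / 2 = z - w by ring,
    show (z - l + w - m) / 2 + (l + m + z - w) / 2 = z by ring,
    show (z - l + w - m) / 2 - (l + m + z - w) / 2 = w - (l + m) by ring,
    show (l + m - z + w) / 2 + (z - l - w + m) / 2 = m by ring,
    show (l + m - z + w) / 2 - (z - l - w + m) / 2 = -(z - w - l) by ring,
    show (z - l + w - m) / 2 + (l + m - z + w) / 2 = w by ring,
    show (z - l + w - m) / 2 - (l + m - z + w) / 2 = z - (l + m) by ring,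
    show (z - l - w + m) / 2 + (l + m + z - w) / 2 = -(w - z - m) by ring,
    show (z - l - w + m) / 2 - (l + m + z - w) / 2 = -l by ring] at h
  simp only [theta₁_neg] at h
  have h1 := theta₁_ne_zero hτ hl
  have h2 := theta₁_ne_zero hτ hm
  have h3 := theta₁_ne_zero hτ hlm
  have h4 := theta₁_ne_zero hτ hz
  have h5 := theta₁_ne_zero hτ hw
  have h6 := theta₁_ne_zero hτ hzw
  have h7 : theta₁ τ (w - z) = -theta₁ τ (z - w) := by rw [← theta₁_neg, neg_sub]
  simp only [sigma, theta₁_neg, h7]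
  generalize theta₁ τ (z - w) = a at *
  generalize theta₁ τ (l + m) = b at *
  field_simp
  linear_combination deriv (theta₁ τ) 0 ^ 2 * h

end Identities

/-! ### Logarithmic derivative of `θ₁` and the limit in (v) -/

section Derivative

variable {τ : ℂ}

theorem deriv_theta₁_neg (z : ℂ) : deriv (theta₁ τ) (-z) = deriv (theta₁ τ) z := by
  have := deriv_comp_neg (theta₁ τ) z
  rw [funext (theta₁_neg (τ := τ)), deriv.fun_neg, neg_inj] at this
  exact this.symm

theorem deriv_theta₁_half : deriv (theta₁ τ) (1 / 2) = 0 := by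
  have := deriv_theta₁_add_one (τ := τ) (-(1 / 2))
  rw [deriv_theta₁_neg, show (-(1 / 2) + 1 : ℂ) = 1 / 2 by norm_num] at this
  exact self_eq_neg.mp this

/-- At a lattice point `θ₁ = (z - p) u` with `u p ≠ 0`, so `θ₁'/θ₁ = 1/(z - p) + u'/u`, with the
same principal part as `ζ`. -/
theorem removable_logDeriv_sub_zeta (hτ : 0 < τ.im) (p : ℂ) : Removable
    (fun z => deriv (theta₁ τ) z / theta₁ τ z - weierstrassZeta (periods τ hτ) z) p := by
  have hf := differentiable_theta₁ hτ
  have hfa := hf.analyticAt p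
  by_cases hp : p ∈ (periods τ hτ).lattice
  · obtain ⟨g, hg, hg'⟩ := exists_zeta_eq_add _ hp
    set u := dslope (theta₁ τ) p with hu
    have hua : AnalyticAt ℂ u p := analyticAt_dslope hfa
    have hup : u p ≠ 0 := by
      rw [hu, dslope_same, Ne, deriv_theta₁_eq_zero_iff hτ hp]
      exact deriv_theta₁_zero_ne_zero hτ
    refine ⟨fun z => deriv u z / u z - g z, (hua.deriv.div hua hup).sub hg, ?_⟩
    filter_upwards [self_mem_nhdsWithin, nhdsWithin_le_nhds hua.eventually_analyticAt,
      nhdsWithin_le_nhds (hua.continuousAt.eventually_ne hup)] with z hz hz1 hz2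
    have hz0 : z - p ≠ 0 := sub_ne_zero.mpr hz
    have hd : deriv (theta₁ τ) z = u z + (z - p) * deriv u z := by
      have h1 := ((hasDerivAt_id z).sub_const p).mul hz1.differentiableAt.hasDerivAt
      have h2 : (fun z => (id z - p) * u z) = theta₁ τ := funext (sub_mul_dslope_theta₁ hτ hp)
      rw [← h2]
      refine h1.deriv.trans ?_
      simp
    rw [hd, ← sub_mul_dslope_theta₁ hτ hp z, hg' z, ← hu]
    field_simp
    ring
  · exact Removable.of_analyticAt ((hfa.deriv.div hfa (theta₁_ne_zero hτ hp)).sub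
      (analyticAt_weierstrassZeta _ hp))

/-- The second logarithmic derivative of `θ₁`. -/
theorem hasDerivAt_logDeriv_theta₁ (hτ : 0 < τ.im) {z : ℂ} (hz : z ∉ (periods τ hτ).lattice) :
    HasDerivAt (fun z => deriv (theta₁ τ) z / theta₁ τ z)
      (-(periods τ hτ).weierstrassP z - 2 * weierstrassZeta (periods τ hτ) (1 / 2)) z := by
  set L := periods τ hτ with hL
  have hf := differentiable_theta₁ hτ
  obtain ⟨H, hH, hMH⟩ := exists_entire_extension (removable_logDeriv_sub_zeta hτ)
  have hHc := hH.continuous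
  -- `θ₁'/θ₁` and `ζ` both change by constants under periods, so `H'` is elliptic and entire, hence
  -- a constant `C`.
  have hshift : ∀ ω ∈ L.lattice, ∀ d : ℂ, (∀ z ∉ L.lattice,
      deriv (theta₁ τ) (z + ω) / theta₁ τ (z + ω) = deriv (theta₁ τ) z / theta₁ τ z + d) →
      ∀ z, deriv H (z + ω) = deriv H z := by
    intro ω hω d hd z
    obtain ⟨c, hc⟩ := exists_weierstrassZeta_add L hω
    have : ∀ p, H (p + ω) = H p + (d - c) := by
      intro p
      refine eq_of_eventuallyEq_nhdsNE (f := fun z => H (z + ω)) (g := fun z => H z + (d - c))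
        (by fun_prop) (by fun_prop) ?_
      filter_upwards [(tendsto_add_nhdsNE p ω).eventually (hMH (p + ω)), hMH p,
        eventually_notMem_lattice hτ p] with z h1 h2 h3
      rw [← h1, ← h2, hd z h3, hc z h3]
      ring
    rw [← deriv_comp_add_const, funext this, deriv_add_const]
  have hdH : Differentiable ℂ (deriv H) := fun z => (hH.analyticAt z).deriv.differentiableAt
  obtain ⟨C, hC⟩ := exists_eq_const_of_periodic hτ hdH
    (hshift 1 (one_mem_lattice hτ) 0 fun z _ => by
      rw [deriv_theta₁_add_one, theta₁_add_one, neg_div_neg_eq, add_zero])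
    (hshift τ (tau_mem_lattice hτ) (-(2 * Real.pi * Complex.I)) fun z hz => by
      have := theta₁_ne_zero hτ hz
      rw [deriv_theta₁_add_tau hτ, theta₁_add_tau, mul_div_mul_left _ _ (by simp)]
      field_simp
      ring)
  have hlin : ∀ z, H z - C * z = H 0 - C * 0 := fun z =>
    is_const_of_deriv_eq_zero (f := fun z => H z - C * z) (by fun_prop) (fun z => by
      rw [deriv_fun_sub (hH z) (by fun_prop), hC]
      simp) z 0
  have hval : ∀ p ∉ L.lattice,
      deriv (theta₁ τ) p / theta₁ τ p - weierstrassZeta L p = H p := fun p hp => by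
    have hfa := hf.analyticAt p
    exact eq_of_eventuallyEq_nhdsNE ((hfa.deriv.div hfa (theta₁_ne_zero hτ hp)).sub
      (analyticAt_weierstrassZeta _ hp)).continuousAt hHc.continuousAt (hMH p)
  have hhalf : (1 / 2 : ℂ) ∉ L.lattice := L.ω₁_div_two_notMem_lattice
  -- Since `θ₁'(±1/2) = 0` and `ζ` is odd, `C = H(1/2) - H(-1/2) = -2 ζ(1/2)`.
  have hCv : C = -(2 * weierstrassZeta L (1 / 2)) := by
    have h1 := hval _ hhalf
    have h2 := hval (-(1 / 2)) (by rwa [neg_mem_iff])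
    rw [deriv_theta₁_half] at h1
    rw [deriv_theta₁_neg, deriv_theta₁_half, weierstrassZeta_neg] at h2
    linear_combination -hlin (1 / 2) + hlin (-(1 / 2)) + h2 - h1
  have hsum := ((hH z).hasDerivAt).add (hasDerivAt_weierstrassZeta L hz)
  rw [hC, hCv] at hsum
  refine (hsum.congr_deriv (by ring)).congr_of_eventuallyEq ?_
  filter_upwards [L.isClosed_lattice.isOpen_compl.mem_nhds hz] with w hw
  rw [Pi.add_apply, ← hval w hw]
  ring

theorem differentiableAt_sigma (hτ : 0 < τ.im) (l : ℂ) {z : ℂ}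
    (hz : z ∉ (periods τ hτ).lattice) : DifferentiableAt ℂ (sigma τ l) z := by
  have hf := differentiable_theta₁ hτ
  -- When `θ₁(-l) = 0`, division by zero makes `sigma τ l` identically `0`.
  by_cases hl : theta₁ τ (-l) = 0
  · have : sigma τ l = fun _ => 0 := by
      funext z
      simp [sigma, hl]
    rw [this]
    fun_prop
  · unfold sigma
    exact DifferentiableAt.div (by fun_prop) (by fun_prop) (mul_ne_zero (theta₁_ne_zero hτ hz) hl)

theorem deriv_sigma (hτ : 0 < τ.im) (l : ℂ) {z : ℂ} (hz : z ∉ (periods τ hτ).lattice) :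
    deriv (sigma τ l) z = deriv (theta₁ τ) 0 / theta₁ τ z ^ 2
      * ((deriv (theta₁ τ) (z - l) * theta₁ τ z - theta₁ τ (z - l) * deriv (theta₁ τ) z)
        / theta₁ τ (-l)) := by
  have hf := differentiable_theta₁ hτ
  have h1 : HasDerivAt (fun z => theta₁ τ (z - l)) (deriv (theta₁ τ) (z - l)) z :=
    (hf (z - l)).hasDerivAt.comp_sub_const z l
  have h2 := ((h1.div (hf z).hasDerivAt (theta₁_ne_zero hτ hz)).const_mul
    (deriv (theta₁ τ) 0 / theta₁ τ (-l)))
  have : sigma τ l = fun z => deriv (theta₁ τ) 0 / theta₁ τ (-l)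
      * (theta₁ τ (z - l) / theta₁ τ z) := by
    funext z
    rw [sigma, div_mul_div_comm]
    ring
  rw [this]
  refine h2.deriv.trans ?_
  ring

/-- Numerator and denominator of the `λ`-dependent factor both vanish at `λ = 0`, so its limit is
the ratio of their `λ`-derivatives there; the total is `(θ₁''θ₁ - θ₁'²)/θ₁² = (θ₁'/θ₁)'`. -/
theorem tendsto_deriv_sigma (hτ : 0 < τ.im) {z : ℂ} (hz : z ∉ (periods τ hτ).lattice) :
    Tendsto (fun l => deriv (sigma τ l) z) (𝓝[≠] 0)
      (𝓝 (-(periods τ hτ).weierstrassP z - 2 * weierstrassZeta (periods τ hτ) (1 / 2))) := by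
  have hf := differentiable_theta₁ hτ
  have hz0 := theta₁_ne_zero hτ hz
  have hK0 := deriv_theta₁_zero_ne_zero hτ
  have hdf : ∀ w, HasDerivAt (theta₁ τ) (deriv (theta₁ τ) w) w := fun w => (hf w).hasDerivAt
  have hddf : HasDerivAt (deriv (theta₁ τ)) (deriv (deriv (theta₁ τ)) (z - 0)) (z - 0) :=
    (hf.analyticAt (z - 0)).deriv.differentiableAt.hasDerivAt
  have hnum : HasDerivAt (fun l => deriv (theta₁ τ) (z - l) * theta₁ τ z
      - theta₁ τ (z - l) * deriv (theta₁ τ) z)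
      (-deriv (deriv (theta₁ τ)) (z - 0) * theta₁ τ z
        - -deriv (theta₁ τ) (z - 0) * deriv (theta₁ τ) z) 0 :=
    ((hddf.comp_const_sub z 0).mul_const _).sub (((hdf (z - 0)).comp_const_sub z 0).mul_const _)
  have hden : HasDerivAt (fun l => theta₁ τ (-l)) (-deriv (theta₁ τ) 0) 0 := by
    rw [funext (theta₁_neg (τ := τ))]
    exact (hdf 0).neg
  have hlim := (hnum.tendsto_slope.div hden.tendsto_slope (neg_ne_zero.mpr hK0)).const_mul
    (deriv (theta₁ τ) 0 / theta₁ τ z ^ 2)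
  have hlog := (hasDerivAt_logDeriv_theta₁ hτ hz).unique
    ((sub_zero z ▸ hddf).div (hdf z) hz0)
  rw [hlog]
  have hval : deriv (theta₁ τ) 0 / theta₁ τ z ^ 2
      * ((-deriv (deriv (theta₁ τ)) (z - 0) * theta₁ τ z
        - -deriv (theta₁ τ) (z - 0) * deriv (theta₁ τ) z) / -deriv (theta₁ τ) 0)
      = (deriv (deriv (theta₁ τ)) z * theta₁ τ z - deriv (theta₁ τ) z * deriv (theta₁ τ) z)
        / theta₁ τ z ^ 2 := by
    rw [sub_zero]
    field_simp
    ring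
  rw [← hval]
  refine hlim.congr' ?_
  filter_upwards [self_mem_nhdsWithin] with l hl
  have hl0 : l ≠ 0 := hl
  rw [deriv_sigma hτ l hz, Pi.div_apply, slope_def_field, slope_def_field, sub_zero l, sub_zero z,
    neg_zero, theta₁_zero, sub_zero, div_div_div_cancel_right₀ hl0]
  congr 2
  ring

end Derivative

end EllipticDunkl

/-! ### Assembly of the five statements -/

theorem mainTheorem11 (τ : ℂ) (hτ : 0 < τ.im) :
    (∀ l z : ℂ, l ∉ (EllipticDunkl.periods τ hτ).lattice →
      z ∉ (EllipticDunkl.periods τ hτ).lattice →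
      EllipticDunkl.sigma τ l z = -EllipticDunkl.sigma τ (-l) (-z)) ∧
    (∀ l z : ℂ, l ∉ (EllipticDunkl.periods τ hτ).lattice →
      z ∉ (EllipticDunkl.periods τ hτ).lattice →
      EllipticDunkl.sigma τ l z = -EllipticDunkl.sigma τ z l) ∧
    (∀ l m z w : ℂ, l ∉ (EllipticDunkl.periods τ hτ).lattice →
      m ∉ (EllipticDunkl.periods τ hτ).lattice →
      l + m ∉ (EllipticDunkl.periods τ hτ).lattice →
      z ∉ (EllipticDunkl.periods τ hτ).lattice →
      w ∉ (EllipticDunkl.periods τ hτ).lattice →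
      z - w ∉ (EllipticDunkl.periods τ hτ).lattice →
      EllipticDunkl.sigma τ l z * EllipticDunkl.sigma τ m w
        - EllipticDunkl.sigma τ (l + m) w * EllipticDunkl.sigma τ l (z - w)
        - EllipticDunkl.sigma τ m (w - z) * EllipticDunkl.sigma τ (l + m) z = 0) ∧
    (∀ l z : ℂ, l ∉ (EllipticDunkl.periods τ hτ).lattice →
      z ∉ (EllipticDunkl.periods τ hτ).lattice →
      EllipticDunkl.sigma τ l z * EllipticDunkl.sigma τ (-l) z
        = (EllipticDunkl.periods τ hτ).weierstrassP z
          - (EllipticDunkl.periods τ hτ).weierstrassP l) ∧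
    (∀ z : ℂ, z ∉ (EllipticDunkl.periods τ hτ).lattice →
      (∀ l : ℂ, l ∉ (EllipticDunkl.periods τ hτ).lattice →
        DifferentiableAt ℂ (EllipticDunkl.sigma τ l) z) ∧
      Tendsto (fun l : ℂ => deriv (EllipticDunkl.sigma τ l) z) (𝓝[≠] 0)
        (𝓝 (-(EllipticDunkl.periods τ hτ).weierstrassP z
          - 2 * EllipticDunkl.weierstrassZeta (EllipticDunkl.periods τ hτ) (1 / 2)))) := by
  refine ⟨fun l z _ _ => ?_, fun l z _ _ => ?_, fun l m z w => EllipticDunkl.sigma_fay hτ,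
    fun l z hl hz => ?_, fun z hz => ⟨fun l _ => EllipticDunkl.differentiableAt_sigma hτ l hz,
      EllipticDunkl.tendsto_deriv_sigma hτ hz⟩⟩
  · rw [EllipticDunkl.sigma, EllipticDunkl.sigma, show -z - -l = -(z - l) by ring]
    simp only [EllipticDunkl.theta₁_neg]
    rw [neg_mul, neg_neg, neg_mul, mul_neg, neg_div_neg_eq]
    ring
  · rw [EllipticDunkl.sigma, EllipticDunkl.sigma, show l - z = -(z - l) by ring]
    simp only [EllipticDunkl.theta₁_neg]
    ring
  · rw [← EllipticDunkl.theta₁_mul_theta₁_div_sq_eq hτ hl hz, EllipticDunkl.sigma,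
      EllipticDunkl.sigma, sub_neg_eq_add, neg_neg]
    ring
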